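/- **Theorem 3.1.** For real matrices let $\|\cdot\|_2$, $\|\cdot\|_F$ denote the spectral and Frobenius norms, and let $\|B\|_{2,\infty}$ be the largest Euclidean norm of a row of $B$. For square matrices $B\in\mathbf R^{\ell\times\ell}$, $C\in\mathbf R^{m\times m}$, a norm $\|\cdot\|_*$ on $\mathbf R^{m\times\ell}$ and a matrix $W$ with $m$ rows and orthonormal columns, put $$\mathsf{sep}_*(B,C)=\inf\{\|ZB-CZ\|_*:\ \|Z\|_*=1\},\qquad \mathsf{sep}_{*,W}(B,C)=\inf\{\|ZB-CZ\|_*:\ \|Z\|_*=1,\ Z\in\operatorname{ran}W\},$$ where $Z$ ranges over $\mathbf R^{m\times\ell}$ and $Z\in\operatorname{ran}W$ means that all columns of $Z$ lie in the column space of $W$. Let $1\le r<n$, let $A\in\mathbf R^{n\times n}$ be symmetric with eigenvalues $\lambda_1\ge\dots\ge\lambda_n$ such that $\lambda_r>\lambda_{r+1}$, and let $$A=V_1\Lambda_1V_1^T+V_2\Lambda_2V_2^T,\qquad \Lambda_1=\operatorname{diag}(\lambda_1,\dots,\lambda_r),\quad \Lambda_2=\operatorname{diag}(\lambda_{r+1},\dots,\lambda_n),$$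 where $V_1\in\mathbf R^{n\times r}$, $V_2\in\mathbf R^{n\times(n-r)}$ and the columns of $[V_1\ V_2]$ form an orthonormal basis of associated eigenvectors. Let $E\in\mathbf R^{n\times n}$ be symmetric, and write $\widehat A=A+E$, $E_{2,1}=V_2^TEV_1$, $E_{2,2}=V_2^TEV_2$, and $$\mathsf{gap}=\min\{\mathsf{sep}_2(\Lambda_1,\Lambda_2),\ \mathsf{sep}_{(2,\infty),V_2}(\Lambda_1,V_2\Lambda_2V_2^T)\}.$$ Suppose that $\|E\|_2\le \mathsf{gap}/5$. Then the $r$-th largest eigenvalue of $\widehat A$ is strictly larger than the $(r+1)$-st, so that the dominant $r$-dimensional invariant subspace of $\widehat A$ (spanned by eigenvectors for its $r$ algebraically largest eigenvalues) is well defined; and for every $\widehat V_1\in\mathbf R^{n\times r}$ with orthonormal columns whose range is this subspace, and every solution $\widetilde U$ of the orthogonal Procrustes problem $\min\{\|\widehat V_1U-V_1\|_F:\ U\in\mathbf R^{r\times r}\text{ orthogonal}\}$, $$\|\widehat V_1\widetilde U-V_1\|_{2,\infty}\le 8\|V_1\|_{2,\infty}\left(\frac{\|E_{2,1}\|_2}{\mathsf{sep}_2(\Lambda_1,\Lambda_2)}\right)^2+2\,\frac{\|V_2E_{2,1}\|_{2,\infty}}{\mathsf{gap}}+4\,\frac{\|V_2E_{2,2}V_2^T\|_{2,\infty}\,\|E_{2,1}\|_2}{\mathsf{gap}\cdot\mathsf{sep}_2(\Lambda_1,\Lambda_2)}.$$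 -/

import Mathlib

open scoped Matrix

noncomputable section

namespace TwoInf

open scoped Matrix.Norms.L2Operator in
/-- The spectral norm `‖B‖₂`: operator norm for the Euclidean norms. -/
def norm2 {m l : ℕ} (B : Matrix (Fin m) (Fin l) ℝ) : ℝ := ‖B‖

open scoped Matrix.Norms.Frobenius in
/-- The Frobenius norm `‖B‖_F`. -/
def normF {m l : ℕ} (B : Matrix (Fin m) (Fin l) ℝ) : ℝ := ‖B‖

/-- The norm `‖B‖_{2,∞}`: the maximal Euclidean norm of a row of `B`. -/
def norm2Inf {m l : ℕ} (B : Matrix (Fin m) (Fin l) ℝ) : ℝ :=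
  ⨆ i : Fin m, ‖WithLp.toLp 2 (B i)‖

/-- `sep_*(B, C) = inf {‖ZB - CZ‖_* : ‖Z‖_* = 1}` for a norm `N = ‖·‖_*` on `m × l` matrices. -/
def sep {m l : ℕ} (N : Matrix (Fin m) (Fin l) ℝ → ℝ)
    (B : Matrix (Fin l) (Fin l) ℝ) (C : Matrix (Fin m) (Fin m) ℝ) : ℝ :=
  sInf {x : ℝ | ∃ Z : Matrix (Fin m) (Fin l) ℝ, N Z = 1 ∧ x = N (Z * B - C * Z)}

/-- `sep_{*,W}(B, C) = inf {‖ZB - CZ‖_* : Z ∈ ran W, ‖Z‖_* = 1}`, where `Z ∈ ran W` says that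
every column of `Z` is in the column space of `W`. -/
def sepOn {m k l : ℕ} (N : Matrix (Fin m) (Fin l) ℝ → ℝ) (W : Matrix (Fin m) (Fin k) ℝ)
    (B : Matrix (Fin l) (Fin l) ℝ) (C : Matrix (Fin m) (Fin m) ℝ) : ℝ :=
  sInf {x : ℝ | ∃ Z : Matrix (Fin m) (Fin l) ℝ,
    (∀ j : Fin l, Z.col j ∈ LinearMap.range W.mulVecLin) ∧ N Z = 1 ∧ x = N (Z * B - C * Z)}

/-- `A = V₁ Λ₁ V₁ᵀ + V₂ Λ₂ V₂ᵀ` is an eigendecomposition of the symmetric matrix `A`, where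
`Λ₁ = diag l₁` holds the `r` algebraically largest eigenvalues, `Λ₂ = diag l₂` the other `n - r`,
both in descending order and with `λ_r > λ_{r+1}`, and the columns of `[V₁ V₂]` are an orthonormal
basis of associated eigenvectors. -/
structure IsEigenSplit {n r : ℕ} (A : Matrix (Fin n) (Fin n) ℝ)
    (V₁ : Matrix (Fin n) (Fin r) ℝ) (V₂ : Matrix (Fin n) (Fin (n - r)) ℝ)
    (l₁ : Fin r → ℝ) (l₂ : Fin (n - r) → ℝ) : Prop where
  orthonormal₁ : V₁ᵀ * V₁ = 1
  orthonormal₂ : V₂ᵀ * V₂ = 1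
  orthogonal : V₁ᵀ * V₂ = 0
  antitone₁ : Antitone l₁
  antitone₂ : Antitone l₂
  separated : ∀ i j, l₂ j < l₁ i
  decomp : A = V₁ * Matrix.diagonal l₁ * V₁ᵀ + V₂ * Matrix.diagonal l₂ * V₂ᵀ

/-- `W` has orthonormal columns and its range is the dominant `r`-dimensional invariant subspace
of `A`, i.e. the span of eigenvectors for the `r` algebraically largest eigenvalues of `A`,
where the `r`-th largest eigenvalue is strictly larger than the next one. -/
def IsDominantBasis {n r : ℕ} (A : Matrix (Fin n) (Fin n) ℝ)
    (W : Matrix (Fin n) (Fin r) ℝ) : Prop :=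
  Wᵀ * W = 1 ∧
    ∃ (V₁ : Matrix (Fin n) (Fin r) ℝ) (V₂ : Matrix (Fin n) (Fin (n - r)) ℝ)
      (l₁ : Fin r → ℝ) (l₂ : Fin (n - r) → ℝ), IsEigenSplit A V₁ V₂ l₁ l₂ ∧
      LinearMap.range W.mulVecLin = LinearMap.range V₁.mulVecLin

/-- `U` solves the orthogonal Procrustes problem `min {‖W U - V‖_F : U ∈ O^r}`. -/
def IsProcrustesSolution {n r : ℕ} (W V : Matrix (Fin n) (Fin r) ℝ)
    (U : Matrix (Fin r) (Fin r) ℝ) : Prop :=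
  U ∈ Matrix.orthogonalGroup (Fin r) ℝ ∧
    ∀ Q ∈ Matrix.orthogonalGroup (Fin r) ℝ, normF (W * U - V) ≤ normF (W * Q - V)

/-- `gap = min {sep₂(Λ₁, Λ₂), sep_{(2,∞),V₂}(Λ₁, V₂ Λ₂ V₂ᵀ)}`. -/
def gap {n r : ℕ} (V₂ : Matrix (Fin n) (Fin (n - r)) ℝ)
    (Λ₁ : Matrix (Fin r) (Fin r) ℝ) (Λ₂ : Matrix (Fin (n - r)) (Fin (n - r)) ℝ) : ℝ :=
  min (sep norm2 Λ₁ Λ₂) (sepOn norm2Inf V₂ Λ₁ (V₂ * Λ₂ * V₂ᵀ))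

end TwoInf

end

/-! Put `C = V₁ᵀWU` and `Y = V₂ᵀWU`, the components of the aligned basis `WU` along and across `ran
V₁`, so that `WU - V₁ = -V₁(1 - C) + V₂Y`. Optimality in the Procrustes problem makes `C` symmetric
positive semidefinite: compare with reflections (`dotProduct_mulVec_nonneg_of_trace_le`) and plane
rotations (`isSymm_of_trace_le`). With `C² + YᵀY = 1` this gives `‖1 - C‖ ≤ ‖Y‖²`
(`norm_one_sub_le_sq`), so the error along `V₁` is of second order. Weyl's inequality
(`sub_norm2_le_eigenvalue`) keeps the two groups of eigenvalues apart, and a Davis–Kahan argument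
(`IsEigenSplit.mul_norm_compl_le`) bounds `‖Y‖` by a multiple of `‖E₂₁‖₂ / sep₂`. For the rows of
`V₂Y`, write `Y = XC`. The tangent `X` solves a Riccati equation; multiplied by `V₂`, it becomes a
Sylvester equation for `V₂X` inside `ran V₂`, where the restricted separation applies
(`IsEigenSplit.gap_mul_norm2Inf_tangent_le`). The terms of its right-hand side containing `V₂X` in
the row norm are absorbed, as `‖E‖₂ ≤ gap/5`. -/

open Matrix

namespace TwoInf

/-! ### Spectral norm estimates and the Sylvester operator. -/

section SpectralNorm

open scoped Matrix.Norms.L2Operator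

variable {k l m n : ℕ}

lemma norm_transpose (B : Matrix (Fin m) (Fin l) ℝ) : ‖Bᵀ‖ = ‖B‖ := by
  rw [← Matrix.conjTranspose_eq_transpose_of_trivial, Matrix.l2_opNorm_conjTranspose]

lemma norm_transpose_mul_self (B : Matrix (Fin m) (Fin l) ℝ) : ‖Bᵀ * B‖ = ‖B‖ * ‖B‖ := by
  rw [← Matrix.conjTranspose_eq_transpose_of_trivial, Matrix.l2_opNorm_conjTranspose_mul_self]

/-- Only an inequality, because in dimension zero the identity has norm 0. -/
lemma norm_one_le : ‖(1 : Matrix (Fin m) (Fin m) ℝ)‖ ≤ 1 := by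
  rw [← Matrix.diagonal_one, Matrix.l2_opNorm_diagonal]
  exact (pi_norm_le_iff_of_nonneg zero_le_one).2 fun i => by simp

lemma norm_le_one_of_orthonormal {V : Matrix (Fin m) (Fin l) ℝ} (hV : Vᵀ * V = 1) : ‖V‖ ≤ 1 := by
  have h := norm_transpose_mul_self V
  rw [hV] at h
  have := norm_one_le (m := l)
  nlinarith [norm_nonneg V]

lemma norm_compression_le {V : Matrix (Fin m) (Fin k) ℝ} {W : Matrix (Fin m) (Fin l) ℝ}
    (hV : Vᵀ * V = 1) (hW : Wᵀ * W = 1) (E : Matrix (Fin m) (Fin m) ℝ) :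
    ‖Vᵀ * E * W‖ ≤ ‖E‖ := by
  have h1 := norm_le_one_of_orthonormal hV
  have h2 := norm_le_one_of_orthonormal hW
  calc ‖Vᵀ * E * W‖ ≤ ‖Vᵀ‖ * ‖E‖ * ‖W‖ :=
        (l2_opNorm_mul _ _).trans
          (mul_le_mul_of_nonneg_right (l2_opNorm_mul _ _) (norm_nonneg _))
    _ ≤ 1 * ‖E‖ * 1 := by rw [norm_transpose]; gcongr
    _ = ‖E‖ := by ring

lemma norm_toLp_mulVec_le (B : Matrix (Fin m) (Fin l) ℝ) (x : Fin l → ℝ) :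
    ‖WithLp.toLp 2 (B *ᵥ x)‖ ≤ ‖B‖ * ‖WithLp.toLp 2 x‖ :=
  l2_opNorm_mulVec B (WithLp.toLp 2 x)

lemma norm_le_of_mulVec_le {B : Matrix (Fin m) (Fin l) ℝ} {c : ℝ} (hc : 0 ≤ c)
    (h : ∀ x : Fin l → ℝ, ‖WithLp.toLp 2 (B *ᵥ x)‖ ≤ c * ‖WithLp.toLp 2 x‖) : ‖B‖ ≤ c := by
  rw [Matrix.l2_opNorm_def]
  exact ContinuousLinearMap.opNorm_le_bound _ hc fun x => h x.ofLp

lemma dotProduct_le_norm_mul_norm (x y : Fin m → ℝ) :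
    x ⬝ᵥ y ≤ ‖WithLp.toLp 2 x‖ * ‖WithLp.toLp 2 y‖ := by
  have h := real_inner_le_norm (WithLp.toLp 2 y) (WithLp.toLp 2 x)
  rw [EuclideanSpace.inner_eq_star_dotProduct] at h
  simpa [mul_comm] using h

lemma dotProduct_self_eq_norm_sq (x : Fin m → ℝ) : x ⬝ᵥ x = ‖WithLp.toLp 2 x‖ ^ 2 := by
  rw [EuclideanSpace.real_norm_sq_eq, dotProduct]
  exact Finset.sum_congr rfl fun i _ => (sq _).symm

lemma abs_dotProduct_mulVec_le (E : Matrix (Fin m) (Fin m) ℝ) (x : Fin m → ℝ) :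
    |x ⬝ᵥ (E *ᵥ x)| ≤ ‖E‖ * (x ⬝ᵥ x) := by
  have key : ∀ F : Matrix (Fin m) (Fin m) ℝ, x ⬝ᵥ (F *ᵥ x) ≤ ‖F‖ * (x ⬝ᵥ x) := fun F => by
    have h1 := dotProduct_le_norm_mul_norm x (F *ᵥ x)
    have h2 := norm_toLp_mulVec_le F x
    rw [dotProduct_self_eq_norm_sq]
    nlinarith [norm_nonneg (WithLp.toLp 2 x)]
  rw [abs_le]
  have h := key (-E)
  rw [neg_mulVec, dotProduct_neg, norm_neg] at h
  exact ⟨by linarith, key E⟩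

/-- The Sylvester operator `Y ↦ Y D - D' Y` is bounded below by the separation of the diagonal
matrices `D` and `D'`, when the spectrum of `D` lies above that of `D'`. -/
lemma mul_norm_le_norm_sylvester {d : Fin l → ℝ} {e : Fin m → ℝ} {a b : ℝ}
    (hd : ∀ i, a ≤ d i) (he : ∀ j, e j ≤ b) (Y : Matrix (Fin m) (Fin l) ℝ) :
    (a - b) * ‖Y‖ ≤ ‖Y * diagonal d - diagonal e * Y‖ := by
  -- Subtracting `s` from both diagonals leaves the Sylvester operator unchanged. For `s` this
  -- negative all shifted entries are nonnegative, so one-sided bounds on the entries become norm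
  -- bounds.
  obtain ⟨s, hs⟩ : ∃ s : ℝ, s = -(‖e‖ + |a| + |b| + 1) := ⟨_, rfl⟩
  have hsa : 0 < a - s := by
    have := neg_abs_le a
    have := norm_nonneg e
    have := abs_nonneg b
    linarith
  have hsb : 0 ≤ b - s := by
    have := neg_abs_le b
    have := norm_nonneg e
    have := abs_nonneg a
    linarith
  have hse : ∀ j, 0 ≤ e j - s := fun j => by
    have h1 := norm_le_pi_norm e j
    have h2 := neg_abs_le (e j)
    rw [Real.norm_eq_abs] at h1
    have := abs_nonneg b
    have := abs_nonneg a
    linarith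
  have hsd : ∀ i, 0 < d i - s := fun i => by linarith [hd i]
  have hN1 : ‖diagonal (fun j => e j - s)‖ ≤ b - s := by
    rw [Matrix.l2_opNorm_diagonal]
    refine (pi_norm_le_iff_of_nonneg hsb).2 fun j => ?_
    rw [Real.norm_eq_abs, abs_of_nonneg (hse j)]
    linarith [he j]
  have hN2 : ‖diagonal (fun i => (d i - s)⁻¹)‖ ≤ (a - s)⁻¹ := by
    rw [Matrix.l2_opNorm_diagonal]
    refine (pi_norm_le_iff_of_nonneg (inv_nonneg.2 hsa.le)).2 fun i => ?_
    rw [Real.norm_eq_abs, abs_of_nonneg (inv_nonneg.2 (hsd i).le)]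
    exact inv_anti₀ hsa (by linarith [hd i])
  have hY : Y = Y * diagonal (fun i => d i - s) * diagonal (fun i => (d i - s)⁻¹) := by
    rw [Matrix.mul_assoc, diagonal_mul_diagonal]
    have : (fun i => (d i - s) * (d i - s)⁻¹) = fun _ => (1 : ℝ) :=
      funext fun i => mul_inv_cancel₀ (hsd i).ne'
    rw [this, diagonal_one, Matrix.mul_one]
  have hlow : (a - s) * ‖Y‖ ≤ ‖Y * diagonal (fun i => d i - s)‖ := by
    have h : ‖Y‖ ≤ ‖Y * diagonal (fun i => d i - s)‖ * (a - s)⁻¹ := by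
      conv_lhs => rw [hY]
      exact (l2_opNorm_mul _ _).trans (mul_le_mul_of_nonneg_left hN2 (norm_nonneg _))
    calc (a - s) * ‖Y‖ ≤ (a - s) * (‖Y * diagonal (fun i => d i - s)‖ * (a - s)⁻¹) :=
          mul_le_mul_of_nonneg_left h hsa.le
      _ = _ := by field_simp
  have hsplit : Y * diagonal (fun i => d i - s)
      = (Y * diagonal d - diagonal e * Y) + diagonal (fun j => e j - s) * Y := by
    ext i j
    simp [mul_diagonal, diagonal_mul]
    ring
  have hup : ‖Y * diagonal (fun i => d i - s)‖
      ≤ ‖Y * diagonal d - diagonal e * Y‖ + (b - s) * ‖Y‖ := by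
    rw [hsplit]
    refine (norm_add_le _ _).trans (add_le_add le_rfl ?_)
    exact (l2_opNorm_mul _ _).trans (mul_le_mul_of_nonneg_right hN1 (norm_nonneg _))
  linarith

/-- A positive semidefinite `C` with `C² = 1 - YᵀY` is quadratically close to the identity. -/
lemma norm_one_sub_le_sq {C : Matrix (Fin l) (Fin l) ℝ} {Y : Matrix (Fin m) (Fin l) ℝ}
    (hpos : ∀ x, 0 ≤ x ⬝ᵥ (C *ᵥ x)) (hC : C * C + Yᵀ * Y = 1) : ‖1 - C‖ ≤ ‖Y‖ ^ 2 := by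
  refine norm_le_of_mulVec_le (sq_nonneg _) fun x => ?_
  obtain ⟨z, hz⟩ : ∃ z, z = (1 - C) *ᵥ x := ⟨_, rfl⟩
  -- Since `C` is positive semidefinite, `1 + C` does not shrink vectors, so this factorization
  -- bounds `1 - C` by `YᵀY`.
  have hmul : (1 + C) * (1 - C) = Yᵀ * Y := by
    rw [← sub_eq_zero]
    linear_combination (norm := noncomm_ring) -hC
  have h1 : (1 + C) *ᵥ z = (Yᵀ * Y) *ᵥ x := by rw [hz, mulVec_mulVec, hmul]
  have h2 : ‖WithLp.toLp 2 z‖ ^ 2 ≤ ‖WithLp.toLp 2 z‖ * ‖WithLp.toLp 2 ((1 + C) *ᵥ z)‖ := by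
    refine le_trans ?_ (dotProduct_le_norm_mul_norm _ _)
    rw [add_mulVec, one_mulVec, dotProduct_add, dotProduct_self_eq_norm_sq]
    linarith [hpos z]
  have h3 : ‖WithLp.toLp 2 z‖ ≤ ‖WithLp.toLp 2 ((1 + C) *ᵥ z)‖ := by
    by_contra! h
    nlinarith [norm_nonneg (WithLp.toLp 2 ((1 + C) *ᵥ z))]
  rw [← hz]
  refine h3.trans ?_
  rw [h1, sq, ← norm_transpose_mul_self]
  exact norm_toLp_mulVec_le _ _

end SpectralNorm

/-! ### The maximal row norm. -/

section RowNorm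

variable {k l m n : ℕ}

lemma norm_row_le_norm2Inf (B : Matrix (Fin m) (Fin l) ℝ) (i : Fin m) :
    ‖WithLp.toLp 2 (B i)‖ ≤ norm2Inf B :=
  le_ciSup (f := fun i => ‖WithLp.toLp 2 (B i)‖) (Set.finite_range _).bddAbove i

lemma norm2Inf_nonneg (B : Matrix (Fin m) (Fin l) ℝ) : 0 ≤ norm2Inf B :=
  Real.iSup_nonneg fun _ => norm_nonneg _

lemma norm2Inf_le {B : Matrix (Fin m) (Fin l) ℝ} {c : ℝ} (hc : 0 ≤ c)
    (h : ∀ i, ‖WithLp.toLp 2 (B i)‖ ≤ c) : norm2Inf B ≤ c :=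
  Real.iSup_le h hc

lemma norm2Inf_zero : norm2Inf (0 : Matrix (Fin m) (Fin l) ℝ) = 0 :=
  le_antisymm (norm2Inf_le le_rfl fun i => by
    change ‖WithLp.toLp 2 (0 : Fin l → ℝ)‖ ≤ 0
    simp) (norm2Inf_nonneg _)

lemma norm2Inf_add_le (B C : Matrix (Fin m) (Fin l) ℝ) :
    norm2Inf (B + C) ≤ norm2Inf B + norm2Inf C :=
  norm2Inf_le (add_nonneg (norm2Inf_nonneg _) (norm2Inf_nonneg _)) fun i => by
    have h : WithLp.toLp 2 ((B + C) i) = WithLp.toLp 2 (B i) + WithLp.toLp 2 (C i) := rfl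
    rw [h]
    exact (norm_add_le _ _).trans
      (add_le_add (norm_row_le_norm2Inf _ _) (norm_row_le_norm2Inf _ _))

lemma norm2Inf_smul (c : ℝ) (B : Matrix (Fin m) (Fin l) ℝ) :
    norm2Inf (c • B) = |c| * norm2Inf B := by
  rw [norm2Inf, norm2Inf, Real.mul_iSup_of_nonneg (abs_nonneg c)]
  refine iSup_congr fun i => ?_
  have h : WithLp.toLp 2 ((c • B) i) = c • WithLp.toLp 2 (B i) := rfl
  rw [h, norm_smul, Real.norm_eq_abs]

lemma norm2Inf_neg (B : Matrix (Fin m) (Fin l) ℝ) : norm2Inf (-B) = norm2Inf B := by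
  have h := norm2Inf_smul (-1) B
  simpa using h

/-- Each row of `B * C` is `Cᵀ` applied to the same row of `B`. -/
lemma norm2Inf_mul_le (B : Matrix (Fin m) (Fin l) ℝ) (C : Matrix (Fin l) (Fin k) ℝ) :
    norm2Inf (B * C) ≤ norm2Inf B * norm2 C := by
  open scoped Matrix.Norms.L2Operator in
  refine norm2Inf_le (mul_nonneg (norm2Inf_nonneg _) (norm_nonneg C)) fun i => ?_
  have h : (B * C) i = Cᵀ *ᵥ B i := by
    rw [mulVec_transpose]
    rfl
  rw [h]
  refine (norm_toLp_mulVec_le _ _).trans ?_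
  rw [norm_transpose, mul_comm]
  exact mul_le_mul_of_nonneg_right (norm_row_le_norm2Inf B i) (norm_nonneg C)

end RowNorm

/-! ### Separations as lower bounds for Sylvester operators. -/

section Separation

variable {k l m n : ℕ}

lemma sepOn_nonneg {N : Matrix (Fin m) (Fin l) ℝ → ℝ} (hN : ∀ Z, 0 ≤ N Z)
    (W : Matrix (Fin m) (Fin k) ℝ) (B : Matrix (Fin l) (Fin l) ℝ)
    (C : Matrix (Fin m) (Fin m) ℝ) : 0 ≤ sepOn N W B C :=
  Real.sInf_nonneg (by rintro x ⟨Z, -, -, rfl⟩; exact hN _)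

lemma sep_nonneg {N : Matrix (Fin m) (Fin l) ℝ → ℝ} (hN : ∀ Z, 0 ≤ N Z)
    (B : Matrix (Fin l) (Fin l) ℝ) (C : Matrix (Fin m) (Fin m) ℝ) : 0 ≤ sep N B C :=
  Real.sInf_nonneg (by rintro x ⟨Z, -, rfl⟩; exact hN _)

lemma sylvester_smul (c : ℝ) (B : Matrix (Fin l) (Fin l) ℝ) (C : Matrix (Fin m) (Fin m) ℝ)
    (Z : Matrix (Fin m) (Fin l) ℝ) : (c • Z) * B - C * (c • Z) = c • (Z * B - C * Z) := by
  rw [Matrix.smul_mul, Matrix.mul_smul, smul_sub]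

lemma sep_mul_le {N : Matrix (Fin m) (Fin l) ℝ → ℝ} (hN : ∀ Z, 0 ≤ N Z)
    (hsmul : ∀ (c : ℝ) Z, N (c • Z) = |c| * N Z) (B : Matrix (Fin l) (Fin l) ℝ)
    (C : Matrix (Fin m) (Fin m) ℝ) (Z : Matrix (Fin m) (Fin l) ℝ) :
    sep N B C * N Z ≤ N (Z * B - C * Z) := by
  rcases (hN Z).eq_or_lt with h | h
  · rw [← h, mul_zero]
    exact hN _
  rw [← le_div_iff₀ h]
  refine csInf_le ⟨0, ?_⟩ ⟨(N Z)⁻¹ • Z, ?_, ?_⟩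
  · rintro x ⟨Z, -, rfl⟩
    exact hN _
  · rw [hsmul, abs_of_pos (inv_pos.2 h), inv_mul_cancel₀ h.ne']
  · rw [sylvester_smul, hsmul, abs_of_pos (inv_pos.2 h), div_eq_inv_mul]

lemma sepOn_mul_le {N : Matrix (Fin m) (Fin l) ℝ → ℝ} (hN : ∀ Z, 0 ≤ N Z)
    (hsmul : ∀ (c : ℝ) Z, N (c • Z) = |c| * N Z) (W : Matrix (Fin m) (Fin k) ℝ)
    (B : Matrix (Fin l) (Fin l) ℝ) (C : Matrix (Fin m) (Fin m) ℝ)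
    (X : Matrix (Fin k) (Fin l) ℝ) :
    sepOn N W B C * N (W * X) ≤ N (W * X * B - C * (W * X)) := by
  rcases (hN (W * X)).eq_or_lt with h | h
  · rw [← h, mul_zero]
    exact hN _
  rw [← le_div_iff₀ h]
  refine csInf_le ⟨0, ?_⟩ ⟨(N (W * X))⁻¹ • (W * X), fun j => ?_, ?_, ?_⟩
  · rintro x ⟨Z, -, -, rfl⟩
    exact hN _
  · refine ⟨(N (W * X))⁻¹ • X.col j, ?_⟩
    rw [mulVecLin_apply, mulVec_smul]
    rfl
  · rw [hsmul, abs_of_pos (inv_pos.2 h), inv_mul_cancel₀ h.ne']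
  · rw [sylvester_smul, hsmul, abs_of_pos (inv_pos.2 h), div_eq_inv_mul]

lemma norm2_nonneg (B : Matrix (Fin m) (Fin l) ℝ) : 0 ≤ norm2 B := by
  open scoped Matrix.Norms.L2Operator in
  exact norm_nonneg B

lemma norm2_smul (c : ℝ) (B : Matrix (Fin m) (Fin l) ℝ) : norm2 (c • B) = |c| * norm2 B := by
  open scoped Matrix.Norms.L2Operator in
  exact (norm_smul c B).trans (by rw [Real.norm_eq_abs]; rfl)

/-- `sep₂` of two diagonal matrices is at most the distance of any two of their entries. -/
lemma sep_norm2_diagonal_le (d : Fin l → ℝ) (e : Fin m → ℝ) (i : Fin l) (j : Fin m)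
    (h : e j ≤ d i) : sep norm2 (diagonal d) (diagonal e) ≤ d i - e j := by
  -- The matrix unit at `(j, i)` is an eigenvector of the Sylvester operator, with eigenvalue `d i -
  -- e j`.
  have hle := sep_mul_le norm2_nonneg norm2_smul (diagonal d) (diagonal e)
    (Matrix.single j i (1 : ℝ))
  have heq : Matrix.single j i (1 : ℝ) * diagonal d - diagonal e * Matrix.single j i (1 : ℝ)
      = (d i - e j) • Matrix.single j i (1 : ℝ) := by
    ext a b
    by_cases ha : j = a
    · by_cases hb : i = b <;> simp [mul_diagonal, diagonal_mul, ha, hb]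
    · simp [mul_diagonal, diagonal_mul, ha]
  rw [heq, norm2_smul, abs_of_nonneg (sub_nonneg.2 h)] at hle
  have hpos : 0 < norm2 (Matrix.single j i (1 : ℝ)) := by
    open scoped Matrix.Norms.L2Operator in
    refine norm_pos_iff.2 fun h0 => ?_
    have := congrFun (congrFun h0 j) i
    simp at this
  exact le_of_mul_le_mul_right hle hpos

end Separation

/-! ### Weyl's inequality and sorted eigendecompositions. -/

section Eigenvalues

variable {k l m n r : ℕ}

lemma dotProduct_mulVec_conj_diagonal (P : Matrix (Fin n) (Fin k) ℝ) (p : Fin k → ℝ)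
    (x : Fin n → ℝ) :
    x ⬝ᵥ ((P * diagonal p * Pᵀ) *ᵥ x) = ∑ i, p i * (Pᵀ *ᵥ x) i ^ 2 := by
  rw [← mulVec_mulVec, ← mulVec_mulVec, dotProduct_mulVec, ← mulVec_transpose]
  simp only [dotProduct, mulVec_diagonal]
  exact Finset.sum_congr rfl fun i _ => by ring

lemma dotProduct_self_eq_sum {P : Matrix (Fin n) (Fin k) ℝ} {Q : Matrix (Fin n) (Fin l) ℝ}
    (h : P * Pᵀ + Q * Qᵀ = 1) (x : Fin n → ℝ) :
    x ⬝ᵥ x = ∑ i, (Pᵀ *ᵥ x) i ^ 2 + ∑ j, (Qᵀ *ᵥ x) j ^ 2 := by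
  have hP := dotProduct_mulVec_conj_diagonal P 1 x
  have hQ := dotProduct_mulVec_conj_diagonal Q 1 x
  have hx : x ⬝ᵥ x = x ⬝ᵥ ((P * Pᵀ + Q * Qᵀ) *ᵥ x) := by rw [h, one_mulVec]
  rw [hx, add_mulVec, dotProduct_add]
  rw [show diagonal (1 : Fin k → ℝ) = 1 from diagonal_one, Matrix.mul_one] at hP
  rw [show diagonal (1 : Fin l → ℝ) = 1 from diagonal_one, Matrix.mul_one] at hQ
  simpa using congrArg₂ (· + ·) hP hQ

/-- Weyl's inequality for an eigenvalue that is not exceeded by those of the complementary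
block. -/
lemma sub_norm2_le_eigenvalue {A E : Matrix (Fin n) (Fin n) ℝ}
    {P P' : Matrix (Fin n) (Fin k) ℝ} {Q : Matrix (Fin n) (Fin l) ℝ}
    {Q' : Matrix (Fin n) (Fin m) ℝ} {p p' : Fin k → ℝ} {q : Fin l → ℝ} {q' : Fin m → ℝ}
    (hP : Pᵀ * P = 1) (hPQ : Pᵀ * Q = 0)
    (hA : A = P * diagonal p * Pᵀ + Q * diagonal q * Qᵀ)
    (hPQ' : P' * P'ᵀ + Q' * Q'ᵀ = 1)
    (hA' : A + E = P' * diagonal p' * P'ᵀ + Q' * diagonal q' * Q'ᵀ)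
    {a : ℝ} (ha : ∀ i, a ≤ p i) (i₀ : Fin k) (hq : ∀ j, q' j ≤ p' i₀) :
    a - norm2 E ≤ p' i₀ := by
  -- One condition fewer than the dimension `k` of `ran P`: some nonzero `x` in `ran P` is
  -- orthogonal to every column of `P'` except the one at `i₀`. Its Rayleigh quotient is at least
  -- `a` for `A` and at most `p' i₀` for `A + E`.
  obtain ⟨f, hf⟩ : ∃ f : (Fin k → ℝ) →ₗ[ℝ] ({i // i ≠ i₀} → ℝ),
      ∀ c i, f c i = ((P'ᵀ * P) *ᵥ c) i.1 :=
    ⟨(LinearMap.funLeft ℝ ℝ Subtype.val) ∘ₗ (P'ᵀ * P).mulVecLin, fun _ _ => rfl⟩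
  have hlt : Module.finrank ℝ ({i // i ≠ i₀} → ℝ) < Module.finrank ℝ (Fin k → ℝ) := by
    rw [Module.finrank_fintype_fun_eq_card, Module.finrank_fintype_fun_eq_card]
    exact Fintype.card_subtype_lt (x := i₀) (by simp)
  obtain ⟨c, hc, hc0⟩ := Submodule.exists_mem_ne_zero_of_ne_bot
    (LinearMap.ker_ne_bot_of_finrank_lt (f := f) hlt)
  obtain ⟨x, hx⟩ : ∃ x, x = P *ᵥ c := ⟨_, rfl⟩
  have hPx : Pᵀ *ᵥ x = c := by rw [hx, mulVec_mulVec, hP, one_mulVec]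
  have hQx : Qᵀ *ᵥ x = 0 := by
    rw [hx, mulVec_mulVec, show Qᵀ * P = (Pᵀ * Q)ᵀ by simp, hPQ]
    simp
  have hxx : x ⬝ᵥ x = ∑ i, c i ^ 2 := by
    conv_lhs => lhs; rw [hx]
    rw [← vecMul_transpose, ← dotProduct_mulVec, hPx]
    exact Finset.sum_congr rfl fun i _ => (sq _).symm
  have hpos : 0 < x ⬝ᵥ x := by
    rw [hxx]
    obtain ⟨i, hi⟩ := Function.ne_iff.1 hc0
    exact Finset.sum_pos' (fun _ _ => sq_nonneg _) ⟨i, Finset.mem_univ _, pow_two_pos_of_ne_zero hi⟩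
  have hzero : ∀ i, i ≠ i₀ → (P'ᵀ *ᵥ x) i = 0 := fun i hi => by
    have h := hf c ⟨i, hi⟩
    rw [LinearMap.mem_ker.1 hc] at h
    rw [hx, mulVec_mulVec]
    exact h.symm
  have hlow : a * (x ⬝ᵥ x) ≤ x ⬝ᵥ (A *ᵥ x) := by
    rw [hA, add_mulVec, dotProduct_add, dotProduct_mulVec_conj_diagonal,
      dotProduct_mulVec_conj_diagonal, hPx, hQx, hxx, Finset.mul_sum]
    simp only [Pi.zero_apply, ne_eq, OfNat.ofNat_ne_zero, not_false_eq_true, zero_pow, mul_zero,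
      Finset.sum_const_zero, add_zero]
    exact Finset.sum_le_sum fun i _ => mul_le_mul_of_nonneg_right (ha i) (sq_nonneg _)
  have hup : x ⬝ᵥ ((A + E) *ᵥ x) ≤ p' i₀ * (x ⬝ᵥ x) := by
    rw [hA', add_mulVec, dotProduct_add, dotProduct_mulVec_conj_diagonal,
      dotProduct_mulVec_conj_diagonal, dotProduct_self_eq_sum hPQ', mul_add, Finset.mul_sum,
      Finset.mul_sum]
    refine add_le_add (Finset.sum_le_sum fun i _ => ?_)
      (Finset.sum_le_sum fun j _ => mul_le_mul_of_nonneg_right (hq j) (sq_nonneg _))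
    by_cases hi : i = i₀
    · rw [hi]
    · simp [hzero i hi]
  have hE : |x ⬝ᵥ (E *ᵥ x)| ≤ norm2 E * (x ⬝ᵥ x) := abs_dotProduct_mulVec_le E x
  rw [add_mulVec, dotProduct_add] at hup
  have := (abs_le.1 hE).1
  refine le_of_mul_le_mul_right ?_ hpos
  linarith

/-- As `r ≤ n`, the matrix `[V₁ V₂]` is square up to reindexing, so its left inverse is a right
inverse. -/
lemma mul_transpose_add_mul_transpose_eq_one {V₁ : Matrix (Fin n) (Fin r) ℝ}
    {V₂ : Matrix (Fin n) (Fin (n - r)) ℝ} (hrn : r ≤ n) (h₁ : V₁ᵀ * V₁ = 1) (h₂ : V₂ᵀ * V₂ = 1)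
    (h₁₂ : V₁ᵀ * V₂ = 0) : V₁ * V₁ᵀ + V₂ * V₂ᵀ = 1 := by
  have h₂₁ : V₂ᵀ * V₁ = 0 := by
    rw [show V₂ᵀ * V₁ = (V₁ᵀ * V₂)ᵀ by simp, h₁₂, transpose_zero]
  rw [← fromCols_mul_fromRows,
    mul_eq_one_comm_of_equiv ((finCongr (by omega)).trans finSumFinEquiv.symm),
    fromRows_mul_fromCols, h₁, h₂, h₁₂, h₂₁, fromBlocks_one]

lemma exists_sorted_spectral {A : Matrix (Fin n) (Fin n) ℝ} (hA : A.IsSymm) :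
    ∃ (V : Matrix (Fin n) (Fin n) ℝ) (μ : Fin n → ℝ), Antitone μ ∧ Vᵀ * V = 1 ∧
      A = V * diagonal μ * Vᵀ := by
  have hH : A.IsHermitian := by
    rw [IsHermitian, conjTranspose_eq_transpose_of_trivial]
    exact hA
  obtain ⟨V, hV⟩ : ∃ V : Matrix (Fin n) (Fin n) ℝ, V = hH.eigenvectorUnitary.1 := ⟨_, rfl⟩
  have hVV : Vᵀ * V = 1 := by
    have h := (mem_unitaryGroup_iff'.1 hH.eigenvectorUnitary.2)
    rw [← hV, star_eq_conjTranspose, conjTranspose_eq_transpose_of_trivial] at h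
    exact h
  have hAV : A = V * diagonal hH.eigenvalues * Vᵀ := by
    have h := hH.spectral_theorem
    rw [Unitary.conjStarAlgAut_apply, ← hV, star_eq_conjTranspose,
      conjTranspose_eq_transpose_of_trivial] at h
    exact h
  -- `Tuple.sort` sorts in ascending order; the reversal makes it descending.
  obtain ⟨σ, hσ⟩ : ∃ σ : Equiv.Perm (Fin n), Antitone (hH.eigenvalues ∘ σ) :=
    ⟨Fin.revPerm.trans (Tuple.sort hH.eigenvalues), fun i j hij =>
      Tuple.monotone_sort hH.eigenvalues (Fin.rev_le_rev.2 hij)⟩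
  refine ⟨V.submatrix id σ, hH.eigenvalues ∘ σ, hσ, ?_, ?_⟩
  · rw [transpose_submatrix, submatrix_mul _ _ _ id _ Function.bijective_id |>.symm, hVV,
      submatrix_one_equiv]
  · rw [transpose_submatrix, ← submatrix_diagonal_equiv, submatrix_mul_equiv, submatrix_mul_equiv,
      submatrix_id_id]
    exact hAV

/-- Eigendecomposition of a symmetric matrix into the `r` largest eigenvalues and the others. -/
lemma exists_weak_eigenSplit {A : Matrix (Fin n) (Fin n) ℝ} (hA : A.IsSymm) (hrn : r ≤ n) :
    ∃ (V₁ : Matrix (Fin n) (Fin r) ℝ) (V₂ : Matrix (Fin n) (Fin (n - r)) ℝ)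
      (l₁ : Fin r → ℝ) (l₂ : Fin (n - r) → ℝ), V₁ᵀ * V₁ = 1 ∧ V₂ᵀ * V₂ = 1 ∧ V₁ᵀ * V₂ = 0 ∧
      Antitone l₁ ∧ Antitone l₂ ∧ (∀ i j, l₂ j ≤ l₁ i) ∧
      A = V₁ * diagonal l₁ * V₁ᵀ + V₂ * diagonal l₂ * V₂ᵀ := by
  obtain ⟨V, μ, hμ, hV, hAV⟩ := exists_sorted_spectral hA
  obtain ⟨e, he₁, he₂⟩ : ∃ e : Fin r ⊕ Fin (n - r) ≃ Fin n,
      (∀ i, (e (.inl i) : ℕ) = i) ∧ ∀ j, (e (.inr j) : ℕ) = r + j :=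
    ⟨finSumFinEquiv.trans (finCongr (by omega)), fun i => by simp, fun j => by simp⟩
  have hVe : ∀ a b, ∑ t, V t (e a) * V t (e b) = (1 : Matrix _ _ ℝ) a b := fun a b => by
    have h := congrFun (congrFun hV (e a)) (e b)
    rw [mul_apply] at h
    simpa [one_apply] using h
  refine ⟨V.submatrix id (e ∘ .inl), V.submatrix id (e ∘ .inr), μ ∘ e ∘ .inl, μ ∘ e ∘ .inr,
    ?_, ?_, ?_, ?_, ?_, ?_, ?_⟩
  · ext a b
    simpa [mul_apply, one_apply] using hVe (.inl a) (.inl b)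
  · ext a b
    simpa [mul_apply, one_apply] using hVe (.inr a) (.inr b)
  · ext a b
    simpa [mul_apply, one_apply] using hVe (.inl a) (.inr b)
  · exact fun i j hij => hμ (Fin.le_def.2 (by simpa [he₁] using hij))
  · exact fun i j hij => hμ (Fin.le_def.2 (by simpa [he₂] using hij))
  · exact fun i j => hμ (Fin.le_def.2 (by simp [he₁, he₂]; omega))
  · rw [hAV]
    ext a b
    rw [Matrix.add_apply, mul_apply, mul_apply, mul_apply, ← e.sum_comp, Fintype.sum_sum_type]
    simp [mul_diagonal]

end Eigenvalues

/-! ### Optimality conditions of the Procrustes problem. -/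

section Procrustes

variable {n r : ℕ}

lemma normF_sq (B : Matrix (Fin n) (Fin r) ℝ) : normF B ^ 2 = (Bᵀ * B).trace := by
  have h : normF B = (∑ i, ∑ j, ‖B i j‖ ^ 2) ^ (1 / 2 : ℝ) := by
    open scoped Matrix.Norms.Frobenius in
    exact (Matrix.frobenius_norm_def B).trans (by simp only [Real.rpow_two])
  rw [h, ← Real.sqrt_eq_rpow, Real.sq_sqrt (by positivity), Finset.sum_comm]
  simp only [trace, diag, mul_apply, transpose_apply, Real.norm_eq_abs, sq_abs]
  exact Finset.sum_congr rfl fun i _ => Finset.sum_congr rfl fun j _ => sq _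

lemma normF_nonneg (B : Matrix (Fin n) (Fin r) ℝ) : 0 ≤ normF B := by
  open scoped Matrix.Norms.Frobenius in
  exact norm_nonneg B

/-- `Q` enters only through the cross term, so minimizing the distance means maximizing `tr(VᵀWQ)`.
-/
lemma normF_sub_sq {W V : Matrix (Fin n) (Fin r) ℝ} (hW : Wᵀ * W = 1)
    {Q : Matrix (Fin r) (Fin r) ℝ} (hQ : Qᵀ * Q = 1) :
    normF (W * Q - V) ^ 2
      = (1 : Matrix (Fin r) (Fin r) ℝ).trace + (Vᵀ * V).trace - 2 * (Vᵀ * W * Q).trace := by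
  have h1 : (W * Q - V)ᵀ * (W * Q - V)
      = Qᵀ * (Wᵀ * W) * Q + Vᵀ * V - Vᵀ * W * Q - (Vᵀ * W * Q)ᵀ := by
    simp only [transpose_sub, transpose_mul, transpose_transpose, Matrix.sub_mul, Matrix.mul_sub,
      Matrix.mul_assoc]
    abel
  rw [normF_sq, h1, hW, Matrix.mul_one, hQ]
  simp only [trace_sub, trace_add, trace_transpose]
  ring

/-- The reflection `1 - 2 v vᵀ / (vᵀ v)`. -/
noncomputable def reflection (v : Fin r → ℝ) : Matrix (Fin r) (Fin r) ℝ :=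
  1 - (2 / (v ⬝ᵥ v)) • vecMulVec v v

lemma reflection_mem {v : Fin r → ℝ} (hv : v ⬝ᵥ v ≠ 0) :
    reflection v ∈ orthogonalGroup (Fin r) ℝ := by
  have ht : (reflection v)ᵀ = reflection v := by
    simp [reflection, transpose_vecMulVec]
  rw [mem_orthogonalGroup_iff', ht]
  have hvv : vecMulVec v v * vecMulVec v v = (v ⬝ᵥ v) • vecMulVec v v := by
    rw [vecMulVec_mul_vecMulVec]
    ext i j
    simp [vecMulVec_apply]
    ring
  simp only [reflection, Matrix.sub_mul, Matrix.mul_sub, Matrix.one_mul, Matrix.mul_one,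
    Matrix.smul_mul, Matrix.mul_smul, hvv, smul_smul]
  have hc : 2 / (v ⬝ᵥ v) * (2 / (v ⬝ᵥ v) * (v ⬝ᵥ v)) = 2 / (v ⬝ᵥ v) + 2 / (v ⬝ᵥ v) := by
    field_simp
    norm_num
  simp only [smul_sub, smul_smul, hc, add_smul]
  abel

lemma trace_mul_vecMulVec (G : Matrix (Fin r) (Fin r) ℝ) (u v : Fin r → ℝ) :
    (G * vecMulVec u v).trace = v ⬝ᵥ (G *ᵥ u) := by
  rw [mul_vecMulVec, trace_vecMulVec, dotProduct_comm]

/-- A matrix whose trace is not increased by any rotation or reflection is positive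
semidefinite. -/
lemma dotProduct_mulVec_nonneg_of_trace_le {G : Matrix (Fin r) (Fin r) ℝ}
    (h : ∀ Q ∈ orthogonalGroup (Fin r) ℝ, (G * Q).trace ≤ G.trace) (v : Fin r → ℝ) :
    0 ≤ v ⬝ᵥ (G *ᵥ v) := by
  by_cases hv : v ⬝ᵥ v = 0
  · rw [dotProduct_self_eq_zero.1 hv]
    simp
  have hpos : 0 < v ⬝ᵥ v :=
    lt_of_le_of_ne (Finset.sum_nonneg fun i _ => mul_self_nonneg _) (Ne.symm hv)
  -- Reflecting along `v` lowers the trace by `2 vᵀGv / vᵀv`.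
  have h1 := h _ (reflection_mem hv)
  rw [reflection, Matrix.mul_sub, Matrix.mul_one, Matrix.mul_smul, trace_sub, trace_smul,
    trace_mul_vecMulVec, smul_eq_mul] at h1
  have h2 : 0 ≤ 2 / (v ⬝ᵥ v) * v ⬝ᵥ (G *ᵥ v) := by linarith
  exact nonneg_of_mul_nonneg_right h2 (by positivity)

/-- The trace is stationary at the identity under rotations of the `(i, j)` plane, and its
derivative there is a multiple of `G j i - G i j`. -/
lemma isSymm_of_trace_le {G : Matrix (Fin r) (Fin r) ℝ}
    (h : ∀ Q ∈ orthogonalGroup (Fin r) ℝ, (G * Q).trace ≤ G.trace) : Gᵀ = G := by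
  ext i j
  rw [transpose_apply]
  by_cases hij : i = j
  · rw [hij]
  -- The rotation is the product of the reflections along `e_i` and `e_i + t e_j`, hence rational in
  -- `t`.
  have key : ∀ t : ℝ, t * (G j i - G i j) ≤ t ^ 2 * (G i i + G j j) := fun t => by
    obtain ⟨u, hu⟩ : ∃ u : Fin r → ℝ, u = Pi.single i 1 := ⟨_, rfl⟩
    obtain ⟨v, hv⟩ : ∃ v : Fin r → ℝ, v = Pi.single i 1 + t • Pi.single j 1 := ⟨_, rfl⟩
    have huu : u ⬝ᵥ u = 1 := by simp [hu]
    have huv : u ⬝ᵥ v = 1 := by simp [hu, hv, hij]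
    have hvv : v ⬝ᵥ v = 1 + t ^ 2 := by
      simp [hv, hij, Ne.symm hij]
      ring
    have hvv0 : 0 < v ⬝ᵥ v := by rw [hvv]; positivity
    have h1 := h _ (mul_mem (reflection_mem (v := u) (by rw [huu]; norm_num))
      (reflection_mem hvv0.ne'))
    have h2 : G * (reflection u * reflection v)
        = G - (2 : ℝ) • (G * vecMulVec u u) - (2 / (v ⬝ᵥ v)) • (G * vecMulVec v v)
          + (4 / (v ⬝ᵥ v)) • (G * vecMulVec u v) := by
      have h3 : vecMulVec u u * vecMulVec v v = vecMulVec u v := by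
        rw [vecMulVec_mul_vecMulVec, huv]
        simp
      simp only [reflection, huu, Matrix.sub_mul, Matrix.mul_sub, Matrix.one_mul, Matrix.mul_one,
        Matrix.smul_mul, Matrix.mul_smul, h3, smul_sub, smul_smul]
      rw [show (4 / (v ⬝ᵥ v)) = 2 / 1 * (2 / (v ⬝ᵥ v)) by ring]
      simp only [div_one]
      rw [mul_comm (2 : ℝ) (2 / _)]
      abel
    rw [h2, trace_add, trace_sub, trace_sub, trace_smul, trace_smul, trace_smul,
      trace_mul_vecMulVec, trace_mul_vecMulVec, trace_mul_vecMulVec] at h1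
    have e1 : u ⬝ᵥ (G *ᵥ u) = G i i := by simp [hu]
    have e2 : v ⬝ᵥ (G *ᵥ u) = G i i + t * G j i := by simp [hu, hv]
    have e3 : v ⬝ᵥ (G *ᵥ v) = G i i + t * G j i + t * (G i j + t * G j j) := by
      simp [hv, mulVec_add, mulVec_smul]
    rw [e1, e2, e3, hvv] at h1
    simp only [smul_eq_mul] at h1
    have hp : (0 : ℝ) < 1 + t ^ 2 := by positivity
    have h4 : 4 / (1 + t ^ 2) * (G i i + t * G j i) - 2 / (1 + t ^ 2) *
        (G i i + t * G j i + t * (G i j + t * G j j)) ≤ 2 * G i i := by linarith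
    have h5 : (4 * (G i i + t * G j i) - 2 *
        (G i i + t * G j i + t * (G i j + t * G j j))) / (1 + t ^ 2) ≤ 2 * G i i := by
      exact le_trans (le_of_eq (by ring)) h4
    rw [div_le_iff₀ hp] at h5
    nlinarith
  obtain ⟨d, hd⟩ : ∃ d, d = G j i - G i j := ⟨_, rfl⟩
  obtain ⟨s, hs⟩ : ∃ s, s = G i i + G j j := ⟨_, rfl⟩
  simp only [← hd, ← hs] at key
  have hd0 : d = 0 := by
    by_contra hne
    have hd2 : 0 < d ^ 2 := pow_two_pos_of_ne_zero hne
    -- This `t` has the sign of `d` and is so small that the linear term exceeds the quadratic one.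
    have h1 := key (d / (2 * (|s| + 1)))
    have hp : 0 < |s| + 1 := by positivity
    have h2 : (d / (2 * (|s| + 1))) * d = d ^ 2 / (2 * (|s| + 1)) := by ring
    have h3 : (d / (2 * (|s| + 1))) ^ 2 * s = d ^ 2 / (2 * (|s| + 1)) * (s / (2 * (|s| + 1))) := by
      ring
    rw [h2, h3] at h1
    have h4 : 0 < d ^ 2 / (2 * (|s| + 1)) := by positivity
    have h5 : s / (2 * (|s| + 1)) < 1 := by
      rw [div_lt_one (by positivity)]
      linarith [le_abs_self s, abs_nonneg s]
    nlinarith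
  linarith

/-- A Procrustes solution maximizes the trace of `Vᵀ W U` over orthogonal `U`. -/
lemma IsProcrustesSolution.trace_le {W V : Matrix (Fin n) (Fin r) ℝ}
    {U : Matrix (Fin r) (Fin r) ℝ} (hW : Wᵀ * W = 1) (h : IsProcrustesSolution W V U)
    (Q : Matrix (Fin r) (Fin r) ℝ) (hQ : Q ∈ orthogonalGroup (Fin r) ℝ) :
    (Vᵀ * W * U * Q).trace ≤ (Vᵀ * W * U).trace := by
  have horth : ∀ {S : Matrix (Fin r) (Fin r) ℝ}, S ∈ orthogonalGroup (Fin r) ℝ → Sᵀ * S = 1 :=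
    fun hS => by simpa [star_eq_conjTranspose] using (mem_orthogonalGroup_iff' _ _).1 hS
  have h1 := h.2 _ (mul_mem h.1 hQ)
  have h2 := pow_le_pow_left₀ (normF_nonneg _) h1 2
  rw [normF_sub_sq hW (horth h.1), normF_sub_sq hW (horth (mul_mem h.1 hQ)), ← Matrix.mul_assoc]
    at h2
  linarith

end Procrustes

/-! ### Perturbation of the invariant subspace. -/

section Perturbation

open scoped Matrix.Norms.L2Operator

variable {n r : ℕ}

lemma IsEigenSplit.completeness {A : Matrix (Fin n) (Fin n) ℝ} {V₁ : Matrix (Fin n) (Fin r) ℝ}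
    {V₂ : Matrix (Fin n) (Fin (n - r)) ℝ} {l₁ : Fin r → ℝ} {l₂ : Fin (n - r) → ℝ}
    (h : IsEigenSplit A V₁ V₂ l₁ l₂) (hrn : r ≤ n) : V₁ * V₁ᵀ + V₂ * V₂ᵀ = 1 :=
  mul_transpose_add_mul_transpose_eq_one hrn h.orthonormal₁ h.orthonormal₂ h.orthogonal

lemma IsEigenSplit.transpose_mul₁ {A : Matrix (Fin n) (Fin n) ℝ} {V₁ : Matrix (Fin n) (Fin r) ℝ}
    {V₂ : Matrix (Fin n) (Fin (n - r)) ℝ} {l₁ : Fin r → ℝ} {l₂ : Fin (n - r) → ℝ}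
    (h : IsEigenSplit A V₁ V₂ l₁ l₂) : V₁ᵀ * A = diagonal l₁ * V₁ᵀ := by
  rw [h.decomp, Matrix.mul_add]
  simp only [← Matrix.mul_assoc, h.orthonormal₁, h.orthogonal, Matrix.one_mul, Matrix.zero_mul,
    add_zero]

lemma IsEigenSplit.orthogonal' {A : Matrix (Fin n) (Fin n) ℝ} {V₁ : Matrix (Fin n) (Fin r) ℝ}
    {V₂ : Matrix (Fin n) (Fin (n - r)) ℝ} {l₁ : Fin r → ℝ} {l₂ : Fin (n - r) → ℝ}
    (h : IsEigenSplit A V₁ V₂ l₁ l₂) : V₂ᵀ * V₁ = 0 := by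
  rw [show V₂ᵀ * V₁ = (V₁ᵀ * V₂)ᵀ by simp, h.orthogonal, transpose_zero]

lemma IsEigenSplit.transpose_mul₂ {A : Matrix (Fin n) (Fin n) ℝ} {V₁ : Matrix (Fin n) (Fin r) ℝ}
    {V₂ : Matrix (Fin n) (Fin (n - r)) ℝ} {l₁ : Fin r → ℝ} {l₂ : Fin (n - r) → ℝ}
    (h : IsEigenSplit A V₁ V₂ l₁ l₂) : V₂ᵀ * A = diagonal l₂ * V₂ᵀ := by
  rw [h.decomp, Matrix.mul_add]
  simp only [← Matrix.mul_assoc, h.orthonormal₂, h.orthogonal', Matrix.one_mul, Matrix.zero_mul,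
    zero_add]

lemma IsEigenSplit.mul₁ {A : Matrix (Fin n) (Fin n) ℝ} {V₁ : Matrix (Fin n) (Fin r) ℝ}
    {V₂ : Matrix (Fin n) (Fin (n - r)) ℝ} {l₁ : Fin r → ℝ} {l₂ : Fin (n - r) → ℝ}
    (h : IsEigenSplit A V₁ V₂ l₁ l₂) : A * V₁ = V₁ * diagonal l₁ := by
  rw [h.decomp, Matrix.add_mul]
  simp only [Matrix.mul_assoc, h.orthonormal₁, h.orthogonal', Matrix.mul_one, Matrix.mul_zero,
    add_zero]

/-- The eigenvalues of the two blocks of a perturbed matrix move by at most `‖E‖₂`. -/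
lemma IsEigenSplit.eigenvalue_perturbation {A E : Matrix (Fin n) (Fin n) ℝ}
    {V₁ V₁' : Matrix (Fin n) (Fin r) ℝ} {V₂ V₂' : Matrix (Fin n) (Fin (n - r)) ℝ}
    {l₁ l₁' : Fin r → ℝ} {l₂ l₂' : Fin (n - r) → ℝ} (hrn : r ≤ n)
    (h : IsEigenSplit A V₁ V₂ l₁ l₂) (h₁ : V₁'ᵀ * V₁' = 1) (h₂ : V₂'ᵀ * V₂' = 1)
    (h₁₂ : V₁'ᵀ * V₂' = 0) (hle : ∀ i j, l₂' j ≤ l₁' i)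
    (hA' : A + E = V₁' * diagonal l₁' * V₁'ᵀ + V₂' * diagonal l₂' * V₂'ᵀ)
    {a b : ℝ} (ha : ∀ i, a ≤ l₁ i) (hb : ∀ j, l₂ j ≤ b) :
    (∀ i, a - norm2 E ≤ l₁' i) ∧ ∀ j, l₂' j ≤ b + norm2 E := by
  have hone := mul_transpose_add_mul_transpose_eq_one hrn h₁ h₂ h₁₂
  refine ⟨fun i => sub_norm2_le_eigenvalue h.orthonormal₁ h.orthogonal h.decomp hone hA' ha i
    fun j => hle i j, fun j => ?_⟩
  have hneg : ∀ {t : ℕ} (d : Fin t → ℝ), diagonal (-d) = -diagonal d :=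
    fun d => (diagonal_neg d).symm
  -- The upper bound is the lower bound for `-A`, where the two blocks exchange roles.
  have hdec : -A = V₂ * diagonal (-l₂) * V₂ᵀ + V₁ * diagonal (-l₁) * V₁ᵀ := by
    rw [h.decomp, hneg, hneg]
    simp only [Matrix.mul_neg, Matrix.neg_mul]
    abel
  have hdec' : -A + -E = V₂' * diagonal (-l₂') * V₂'ᵀ + V₁' * diagonal (-l₁') * V₁'ᵀ := by
    rw [← neg_add, hA', hneg, hneg]
    simp only [Matrix.mul_neg, Matrix.neg_mul]
    abel
  have hw := sub_norm2_le_eigenvalue h.orthonormal₂ h.orthogonal' hdec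
    (by rw [add_comm, hone]) hdec' (a := -b) (fun i => neg_le_neg (hb i)) j
    fun i => neg_le_neg (hle i j)
  have hE : norm2 (-E) = norm2 E := norm_neg E
  rw [hE, Pi.neg_apply] at hw
  linarith

/-- Sine theta bounds for a dominant eigenbasis `V₁'` of `A + E`. -/
lemma IsEigenSplit.mul_norm_compl_le {A E : Matrix (Fin n) (Fin n) ℝ}
    {V₁ W : Matrix (Fin n) (Fin r) ℝ} {V₂ : Matrix (Fin n) (Fin (n - r)) ℝ}
    {l₁ d : Fin r → ℝ} {l₂ : Fin (n - r) → ℝ} (hrn : r ≤ n)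
    (h : IsEigenSplit A V₁ V₂ l₁ l₂) (hW : Wᵀ * W = 1) (hd : (A + E) * W = W * diagonal d)
    {a b : ℝ} (ha : ∀ i, a ≤ d i) (hb : ∀ j, l₂ j ≤ b) :
    (a - b) * ‖V₂ᵀ * W‖ ≤ ‖E‖ ∧
      (a - b) * ‖V₂ᵀ * W‖ ≤ ‖V₂ᵀ * E * V₁‖ + ‖E‖ * ‖V₂ᵀ * W‖ := by
  have hsyl : V₂ᵀ * W * diagonal d - diagonal l₂ * (V₂ᵀ * W) = V₂ᵀ * E * W := by
    rw [Matrix.mul_assoc, ← hd, ← Matrix.mul_assoc (diagonal l₂), ← h.transpose_mul₂,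
      Matrix.add_mul, Matrix.mul_add]
    simp only [Matrix.mul_assoc]
    abel
  have hlow := mul_norm_le_norm_sylvester ha hb (V₂ᵀ * W)
  rw [hsyl] at hlow
  refine ⟨hlow.trans (norm_compression_le h.orthonormal₂ hW E), hlow.trans ?_⟩
  -- Splitting `W` along `V₁` and `V₂` isolates `E₂₁`; the rest is proportional to `V₂ᵀW` and can be
  -- absorbed later.
  have hEW : V₂ᵀ * E * W = V₂ᵀ * E * V₁ * (V₁ᵀ * W) + V₂ᵀ * E * V₂ * (V₂ᵀ * W) := by
    calc V₂ᵀ * E * W = V₂ᵀ * E * ((V₁ * V₁ᵀ + V₂ * V₂ᵀ) * W) := by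
          rw [h.completeness hrn, Matrix.one_mul]
      _ = _ := by simp only [Matrix.add_mul, Matrix.mul_add, Matrix.mul_assoc]
  have hC : ‖V₁ᵀ * W‖ ≤ 1 := by
    have h1 := norm_compression_le h.orthonormal₁ hW 1
    rw [Matrix.mul_one] at h1
    exact h1.trans norm_one_le
  rw [hEW]
  refine (norm_add_le _ _).trans (add_le_add ?_ ?_)
  · refine (l2_opNorm_mul _ _).trans ?_
    exact mul_le_of_le_one_right (norm_nonneg _) hC
  · refine (l2_opNorm_mul _ _).trans ?_
    exact mul_le_mul_of_nonneg_right (norm_compression_le h.orthonormal₂ h.orthonormal₂ E)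
      (norm_nonneg _)

lemma mul_left_injective_of_inv {k l : ℕ} (C D : Matrix (Fin l) (Fin l) ℝ) (h : C * D = 1) :
    Function.Injective fun B : Matrix (Fin k) (Fin l) ℝ => B * C := fun B B' hB => by
  have h1 := congrArg (· * D) hB
  simpa only [Matrix.mul_assoc, h, Matrix.mul_one] using h1

/-- A kernel vector of `C` is fixed by the strict contraction `1 - C`, hence zero. -/
lemma isUnit_of_norm_one_sub_lt {C : Matrix (Fin r) (Fin r) ℝ} (hC : ‖1 - C‖ < 1) :
    IsUnit C := by
  rw [← mulVec_injective_iff_isUnit, ← coe_mulVecLin, ← LinearMap.ker_eq_bot,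
    LinearMap.ker_eq_bot']
  intro x hx
  have hx' : C *ᵥ x = 0 := hx
  have h := norm_toLp_mulVec_le (1 - C) x
  rw [sub_mulVec, one_mulVec, hx', sub_zero] at h
  have h0 : ‖WithLp.toLp 2 x‖ = 0 := by nlinarith [norm_nonneg (WithLp.toLp 2 x)]
  simpa using h0

/-- Row-wise bound for the tangent `V₂ X` of an invariant subspace `ran ((V₁ + V₂ X) C)`
of `A + E`, from the quadratic equation that `X` satisfies. -/
lemma IsEigenSplit.gap_mul_norm2Inf_tangent_le {A E : Matrix (Fin n) (Fin n) ℝ}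
    {V₁ W : Matrix (Fin n) (Fin r) ℝ} {V₂ : Matrix (Fin n) (Fin (n - r)) ℝ}
    {l₁ : Fin r → ℝ} {l₂ : Fin (n - r) → ℝ} {X : Matrix (Fin (n - r)) (Fin r) ℝ}
    {M : Matrix (Fin r) (Fin r) ℝ} (hrn : r ≤ n) (h : IsEigenSplit A V₁ V₂ l₁ l₂)
    (hM : (A + E) * W = W * M) (hC : IsUnit (V₁ᵀ * W)) (hX : X * (V₁ᵀ * W) = V₂ᵀ * W) :
    gap V₂ (diagonal l₁) (diagonal l₂) * norm2Inf (V₂ * X) ≤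
      norm2Inf (V₂ * (V₂ᵀ * E * V₁)) + norm2Inf (V₂ * (V₂ᵀ * E * V₂) * V₂ᵀ) * ‖X‖
        + norm2Inf (V₂ * X) * (‖E‖ * (1 + ‖X‖)) := by
  have hW : (V₁ + V₂ * X) * (V₁ᵀ * W) = W := by
    rw [Matrix.add_mul, Matrix.mul_assoc V₂, hX, ← Matrix.mul_assoc, ← Matrix.mul_assoc,
      ← Matrix.add_mul, h.completeness hrn, Matrix.one_mul]
  have hM₁ : diagonal l₁ * (V₁ᵀ * W) = V₁ᵀ * W * M - V₁ᵀ * E * W := by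
    rw [← Matrix.mul_assoc, ← h.transpose_mul₁, Matrix.mul_assoc V₁ᵀ W, ← hM, Matrix.add_mul,
      Matrix.mul_add, ← Matrix.mul_assoc, ← Matrix.mul_assoc]
    abel
  have hM₂ : diagonal l₂ * (V₂ᵀ * W) = V₂ᵀ * W * M - V₂ᵀ * E * W := by
    rw [← Matrix.mul_assoc, ← h.transpose_mul₂, Matrix.mul_assoc V₂ᵀ W, ← hM, Matrix.add_mul,
      Matrix.mul_add, ← Matrix.mul_assoc, ← Matrix.mul_assoc]
    abel
  -- The Riccati equation: after multiplication by the invertible `V₁ᵀW`, both terms on the left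
  -- produce `V₂ᵀWM`, so the unknown `M` cancels.
  have hric : X * diagonal l₁ - diagonal l₂ * X
      = V₂ᵀ * E * (V₁ + V₂ * X) - X * (V₁ᵀ * E * (V₁ + V₂ * X)) := by
    have hCinv := mul_nonsing_inv _ ((isUnit_iff_isUnit_det _).1 hC)
    refine (mul_left_injective_of_inv _ _ hCinv) ?_
    dsimp only
    rw [Matrix.sub_mul, Matrix.sub_mul, Matrix.mul_assoc, hM₁, Matrix.mul_assoc (diagonal l₂), hX,
      hM₂, Matrix.mul_assoc (V₂ᵀ * E), hW, Matrix.mul_assoc X, Matrix.mul_assoc (V₁ᵀ * E), hW,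
      Matrix.mul_sub, ← Matrix.mul_assoc X, hX]
    abel
  have hsyl : V₂ * X * diagonal l₁ - V₂ * diagonal l₂ * V₂ᵀ * (V₂ * X)
      = V₂ * (V₂ᵀ * E * V₁) + V₂ * (V₂ᵀ * E * V₂) * V₂ᵀ * (V₂ * X)
        - V₂ * X * (V₁ᵀ * E * (V₁ + V₂ * X)) := by
    have e1 : V₂ᵀ * (V₂ * X) = X := by
      rw [← Matrix.mul_assoc, h.orthonormal₂, Matrix.one_mul]
    rw [Matrix.mul_assoc _ V₂ᵀ, Matrix.mul_assoc _ V₂ᵀ, e1]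
    calc V₂ * X * diagonal l₁ - V₂ * diagonal l₂ * X
        = V₂ * (X * diagonal l₁ - diagonal l₂ * X) := by
          simp only [Matrix.mul_sub, Matrix.mul_assoc]
      _ = _ := by
          rw [hric]
          simp only [Matrix.mul_sub, Matrix.mul_add, Matrix.mul_assoc]
  have hsep := sepOn_mul_le norm2Inf_nonneg norm2Inf_smul V₂ (diagonal l₁)
    (V₂ * diagonal l₂ * V₂ᵀ) X
  rw [hsyl, sub_eq_add_neg] at hsep
  have hX' : norm2 (V₂ * X) ≤ ‖X‖ :=
    (l2_opNorm_mul V₂ X).trans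
      (mul_le_of_le_one_left (norm_nonneg _) (norm_le_one_of_orthonormal h.orthonormal₂))
  have hR : norm2 (V₁ᵀ * E * (V₁ + V₂ * X)) ≤ ‖E‖ * (1 + ‖X‖) := by
    have e2 : V₁ᵀ * E * (V₁ + V₂ * X) = V₁ᵀ * E * V₁ + V₁ᵀ * E * V₂ * X := by
      simp only [Matrix.mul_add, Matrix.mul_assoc]
    rw [e2]
    refine (norm_add_le _ _).trans ?_
    rw [mul_add, mul_one]
    refine add_le_add (norm_compression_le h.orthonormal₁ h.orthonormal₁ E)
      ((l2_opNorm_mul _ _).trans ?_)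
    exact mul_le_mul_of_nonneg_right (norm_compression_le h.orthonormal₁ h.orthonormal₂ E)
      (norm_nonneg _)
  refine (mul_le_mul_of_nonneg_right (min_le_right _ _) (norm2Inf_nonneg _)).trans
    (hsep.trans ?_)
  refine (norm2Inf_add_le _ _).trans (add_le_add ((norm2Inf_add_le _ _).trans ?_) ?_)
  · exact add_le_add le_rfl ((norm2Inf_mul_le _ _).trans
      (mul_le_mul_of_nonneg_left hX' (norm2Inf_nonneg _)))
  · rw [norm2Inf_neg]
    exact (norm2Inf_mul_le _ _).trans (mul_le_mul_of_nonneg_left hR (norm2Inf_nonneg _))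

/-- A basis with orthonormal columns of the range of `V` is an orthogonal transform of `V`. -/
lemma exists_orthogonal_of_range_eq {W V : Matrix (Fin n) (Fin r) ℝ} (hW : Wᵀ * W = 1)
    (hV : Vᵀ * V = 1) (h : LinearMap.range W.mulVecLin = LinearMap.range V.mulVecLin) :
    ∃ R : Matrix (Fin r) (Fin r) ℝ, Rᵀ * R = 1 ∧ W = V * R := by
  have hcol : ∀ j, ∃ c, V *ᵥ c = W.col j := fun j => by
    have hmem : W.col j ∈ LinearMap.range W.mulVecLin := ⟨Pi.single j 1, by simp⟩
    rw [h] at hmem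
    exact hmem
  choose c hc using hcol
  have hWR : W = V * (of c)ᵀ := by
    ext i j
    exact (congrFun (hc j) i).symm
  refine ⟨(of c)ᵀ, ?_, hWR⟩
  calc (of c)ᵀᵀ * (of c)ᵀ = (of c)ᵀᵀ * (Vᵀ * V) * (of c)ᵀ := by rw [hV, Matrix.mul_one]
    _ = (V * (of c)ᵀ)ᵀ * (V * (of c)ᵀ) := by simp only [transpose_mul, Matrix.mul_assoc]
    _ = 1 := by rw [← hWR, hW]

/-- Decomposition of `W - V₁` along `ran V₁` and `ran V₂` for a basis `W` that is aligned with
`V₁`. -/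
lemma IsEigenSplit.aligned_decomposition {A : Matrix (Fin n) (Fin n) ℝ}
    {V₁ W : Matrix (Fin n) (Fin r) ℝ} {V₂ : Matrix (Fin n) (Fin (n - r)) ℝ}
    {l₁ : Fin r → ℝ} {l₂ : Fin (n - r) → ℝ} (hrn : r ≤ n)
    (h : IsEigenSplit A V₁ V₂ l₁ l₂) (hW : Wᵀ * W = 1)
    (hsymm : (V₁ᵀ * W)ᵀ = V₁ᵀ * W) (hpos : ∀ x, 0 ≤ x ⬝ᵥ ((V₁ᵀ * W) *ᵥ x)) :
    W - V₁ = -(V₁ * (1 - V₁ᵀ * W)) + V₂ * (V₂ᵀ * W) ∧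
      ‖1 - V₁ᵀ * W‖ ≤ ‖V₂ᵀ * W‖ ^ 2 := by
  constructor
  · have hWCY : W = V₁ * (V₁ᵀ * W) + V₂ * (V₂ᵀ * W) := by
      rw [← Matrix.mul_assoc, ← Matrix.mul_assoc, ← Matrix.add_mul, h.completeness hrn,
        Matrix.one_mul]
    rw [Matrix.mul_sub, Matrix.mul_one]
    conv_lhs => rw [hWCY]
    abel
  · refine norm_one_sub_le_sq hpos ?_
    calc V₁ᵀ * W * (V₁ᵀ * W) + (V₂ᵀ * W)ᵀ * (V₂ᵀ * W)
        = (V₁ᵀ * W)ᵀ * (V₁ᵀ * W) + (V₂ᵀ * W)ᵀ * (V₂ᵀ * W) := by rw [hsymm]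
      _ = Wᵀ * ((V₁ * V₁ᵀ + V₂ * V₂ᵀ) * W) := by
          simp only [transpose_mul, transpose_transpose, Matrix.add_mul, Matrix.mul_add,
            Matrix.mul_assoc]
      _ = 1 := by rw [h.completeness hrn, Matrix.one_mul, hW]

/-- The deviation bound for a basis `W` that is aligned with `V₁`, in the sense that `V₁ᵀ W` is
positive semidefinite. -/
lemma IsEigenSplit.norm2Inf_sub_le {A E : Matrix (Fin n) (Fin n) ℝ}
    {V₁ W : Matrix (Fin n) (Fin r) ℝ} {V₂ : Matrix (Fin n) (Fin (n - r)) ℝ}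
    {l₁ : Fin r → ℝ} {l₂ : Fin (n - r) → ℝ} {M : Matrix (Fin r) (Fin r) ℝ} {s : ℝ} (hrn : r ≤ n)
    (h : IsEigenSplit A V₁ V₂ l₁ l₂) (hW : Wᵀ * W = 1) (hM : (A + E) * W = W * M)
    (hsymm : (V₁ᵀ * W)ᵀ = V₁ᵀ * W) (hpos : ∀ x, 0 ≤ x ⬝ᵥ ((V₁ᵀ * W) *ᵥ x))
    (hgap : 0 < gap V₂ (diagonal l₁) (diagonal l₂)) (hs : 0 < s)
    (hE : norm2 E ≤ gap V₂ (diagonal l₁) (diagonal l₂) / 5)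
    (hY : ‖V₂ᵀ * W‖ ≤ 1 / 4) (hY' : 3 / 5 * s * ‖V₂ᵀ * W‖ ≤ norm2 (V₂ᵀ * E * V₁)) :
    norm2Inf (W - V₁) ≤
      8 * norm2Inf V₁ * (norm2 (V₂ᵀ * E * V₁) / s) ^ 2
        + 2 * (norm2Inf (V₂ * (V₂ᵀ * E * V₁)) / gap V₂ (diagonal l₁) (diagonal l₂))
        + 4 * (norm2Inf (V₂ * (V₂ᵀ * E * V₂) * V₂ᵀ) * norm2 (V₂ᵀ * E * V₁) /
            (gap V₂ (diagonal l₁) (diagonal l₂) * s)) := by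
  obtain ⟨C, hCdef⟩ : ∃ C, C = V₁ᵀ * W := ⟨_, rfl⟩
  obtain ⟨Y, hYdef⟩ : ∃ Y, Y = V₂ᵀ * W := ⟨_, rfl⟩
  obtain ⟨g, hg⟩ : ∃ g, g = gap V₂ (diagonal l₁) (diagonal l₂) := ⟨_, rfl⟩
  obtain ⟨hWV, hC1⟩ := h.aligned_decomposition hrn hW hsymm hpos
  rw [← hCdef, ← hYdef] at hWV hC1
  rw [← hYdef] at hY hY'
  rw [← hg] at hgap hE ⊢
  have hC16 : ‖1 - C‖ ≤ 1 / 16 := hC1.trans (by nlinarith [norm_nonneg Y])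
  have hCu : IsUnit C := isUnit_of_norm_one_sub_lt (by linarith)
  have hCn : norm2 C ≤ 1 := by
    have h1 := norm_compression_le h.orthonormal₁ hW 1
    rw [Matrix.mul_one, ← hCdef] at h1
    exact h1.trans norm_one_le
  obtain ⟨X, hX⟩ : ∃ X, X * C = Y := ⟨Y * C⁻¹, by
    rw [Matrix.mul_assoc, nonsing_inv_mul _ ((isUnit_iff_isUnit_det _).1 hCu), Matrix.mul_one]⟩
  have hXY : 15 / 16 * ‖X‖ ≤ ‖Y‖ := by
    -- Absorbing `X(1 - C)`, where `‖1 - C‖ ≤ 1/16`, leaves the factor 15/16.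
    have h1 : X = Y + X * (1 - C) := by
      rw [Matrix.mul_sub, hX, Matrix.mul_one]
      abel
    have h2 : ‖X‖ ≤ ‖Y‖ + ‖X‖ * ‖1 - C‖ := by
      conv_lhs => rw [h1]
      exact (norm_add_le _ _).trans (add_le_add le_rfl (l2_opNorm_mul _ _))
    nlinarith [norm_nonneg X]
  have htan := h.gap_mul_norm2Inf_tangent_le hrn hM (hCdef ▸ hCu) (by rw [← hCdef, ← hYdef, hX])
  rw [← hg] at htan
  have hV₂Y : norm2Inf (V₂ * Y) ≤ norm2Inf (V₂ * X) := by
    rw [← hX, ← Matrix.mul_assoc]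
    exact (norm2Inf_mul_le _ _).trans (mul_le_of_le_one_right (norm2Inf_nonneg _) hCn)
  have hdiff : norm2Inf (W - V₁) ≤ norm2Inf V₁ * ‖1 - C‖ + norm2Inf (V₂ * X) := by
    rw [hWV]
    refine (norm2Inf_add_le _ _).trans (add_le_add ?_ hV₂Y)
    rw [norm2Inf_neg]
    exact norm2Inf_mul_le _ _
  obtain ⟨e, he⟩ : ∃ e, e = norm2 (V₂ᵀ * E * V₁) / s := ⟨_, rfl⟩
  have he' : norm2 (V₂ᵀ * E * V₁) = e * s := by rw [he, div_mul_cancel₀ _ hs.ne']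
  have hYe : ‖Y‖ ≤ 5 / 3 * e := by
    rw [he'] at hY'
    exact le_of_mul_le_mul_right (by linarith) hs
  have hY0 := norm_nonneg Y
  have hX0 := norm_nonneg X
  have he0 : 0 ≤ e := by linarith
  have hXe : ‖X‖ ≤ 16 / 9 * e := by linarith
  have hX1 : ‖X‖ ≤ 4 / 15 := by linarith
  obtain ⟨a, ha⟩ : ∃ a, a = norm2Inf (V₂ * (V₂ᵀ * E * V₁)) := ⟨_, rfl⟩
  obtain ⟨b, hb⟩ : ∃ b, b = norm2Inf (V₂ * (V₂ᵀ * E * V₂) * V₂ᵀ) := ⟨_, rfl⟩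
  obtain ⟨z, hz⟩ : ∃ z, z = norm2Inf (V₂ * X) := ⟨_, rfl⟩
  have ha0 : 0 ≤ a := ha ▸ norm2Inf_nonneg _
  have hb0 : 0 ≤ b := hb ▸ norm2Inf_nonneg _
  have hz0 : 0 ≤ z := hz ▸ norm2Inf_nonneg _
  have hV0 := norm2Inf_nonneg V₁
  have hE' : ‖E‖ ≤ g / 5 := hE
  rw [← ha, ← hb, ← hz] at htan
  rw [← hz] at hdiff
  rw [← ha, ← hb, mul_div_mul_comm, ← he]
  have hEX : ‖E‖ * (1 + ‖X‖) ≤ g / 5 * (19 / 15) :=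
    mul_le_mul hE' (by linarith) (by linarith) (by linarith)
  have hbX : b * ‖X‖ ≤ b * (16 / 9 * e) := mul_le_mul_of_nonneg_left hXe hb0
  have hzE : z * (‖E‖ * (1 + ‖X‖)) ≤ z * (g / 5 * (19 / 15)) := mul_le_mul_of_nonneg_left hEX hz0
  have hbe : 0 ≤ b * e := mul_nonneg hb0 he0
  -- The absorbed term is `19/75 · zg`, so `zg ≤ 75/56 · (a + 16/9 · be)`; the constants 2 and 4
  -- leave room.
  have hzg : z * g ≤ 2 * a + 4 * (b * e) := by nlinarith
  have hzb : z ≤ 2 * (a / g) + 4 * (b / g * e) := by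
    rw [← le_div_iff₀ hgap] at hzg
    refine hzg.trans (le_of_eq ?_)
    ring
  -- Here `(5/3)² = 25/9` would suffice in place of 8.
  have hCe : ‖1 - C‖ ≤ 8 * e ^ 2 := hC1.trans (by nlinarith)
  have hVC : norm2Inf V₁ * ‖1 - C‖ ≤ norm2Inf V₁ * (8 * e ^ 2) :=
    mul_le_mul_of_nonneg_left hCe hV0
  linarith

end Perturbation

end TwoInf

/-! ### Assembly of the main theorem. -/

theorem theorem3p1 (n r : ℕ) (hr : 0 < r) (hrn : r < n)
    (A E : Matrix (Fin n) (Fin n) ℝ) (hA : A.IsSymm) (hE : E.IsSymm)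
    (V₁ : Matrix (Fin n) (Fin r) ℝ) (V₂ : Matrix (Fin n) (Fin (n - r)) ℝ)
    (l₁ : Fin r → ℝ) (l₂ : Fin (n - r) → ℝ)
    (hsplit : TwoInf.IsEigenSplit A V₁ V₂ l₁ l₂)
    (hgap : TwoInf.norm2 E ≤
      TwoInf.gap V₂ (Matrix.diagonal l₁) (Matrix.diagonal l₂) / 5) :
    (∃ W : Matrix (Fin n) (Fin r) ℝ, TwoInf.IsDominantBasis (A + E) W) ∧
    ∀ (W : Matrix (Fin n) (Fin r) ℝ) (U : Matrix (Fin r) (Fin r) ℝ),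
      TwoInf.IsDominantBasis (A + E) W → TwoInf.IsProcrustesSolution W V₁ U →
      TwoInf.norm2Inf (W * U - V₁) ≤
        8 * TwoInf.norm2Inf V₁ *
          (TwoInf.norm2 (V₂ᵀ * E * V₁) /
            TwoInf.sep TwoInf.norm2 (Matrix.diagonal l₁) (Matrix.diagonal l₂)) ^ 2
        + 2 * (TwoInf.norm2Inf (V₂ * (V₂ᵀ * E * V₁)) /
            TwoInf.gap V₂ (Matrix.diagonal l₁) (Matrix.diagonal l₂))
        + 4 * (TwoInf.norm2Inf (V₂ * (V₂ᵀ * E * V₂) * V₂ᵀ) * TwoInf.norm2 (V₂ᵀ * E * V₁) /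
            (TwoInf.gap V₂ (Matrix.diagonal l₁) (Matrix.diagonal l₂) *
              TwoInf.sep TwoInf.norm2 (Matrix.diagonal l₁) (Matrix.diagonal l₂))) := by
  open TwoInf in
  open scoped Matrix.Norms.L2Operator in
  have hr' : r - 1 < r := by omega
  have hm : 0 < n - r := by omega
  obtain ⟨a, ha⟩ : ∃ a, a = l₁ ⟨r - 1, hr'⟩ := ⟨_, rfl⟩
  obtain ⟨b, hb⟩ : ∃ b, b = l₂ ⟨0, hm⟩ := ⟨_, rfl⟩
  have hal : ∀ i, a ≤ l₁ i := fun i =>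
    ha ▸ hsplit.antitone₁ (Fin.le_def.2 (by have := i.2; simp only; omega))
  have hbl : ∀ j, l₂ j ≤ b := fun j => hb ▸ hsplit.antitone₂ (Fin.le_def.2 (Nat.zero_le _))
  have hba : b < a := by
    rw [ha, hb]
    exact hsplit.separated _ _
  -- With `a = λ_r` and `b = λ_{r+1}`, this gives `gap ≤ sep₂ ≤ a - b`, so `‖E‖₂` is at most a fifth
  -- of the eigenvalue gap.
  have hsep : sep norm2 (diagonal l₁) (diagonal l₂) ≤ a - b := by
    rw [ha, hb]
    exact sep_norm2_diagonal_le _ _ _ _ (hsplit.separated _ _).le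
  have hgs : gap V₂ (diagonal l₁) (diagonal l₂) ≤ sep norm2 (diagonal l₁) (diagonal l₂) :=
    min_le_left _ _
  have hEab : norm2 E ≤ (a - b) / 5 := by linarith
  constructor
  · obtain ⟨P, Q, p, q, hP, hQ, hPQ, hp, hq, hpq, hdec⟩ :=
      exists_weak_eigenSplit (hA.add hE) hrn.le
    obtain ⟨h1, h2⟩ := hsplit.eigenvalue_perturbation hrn.le hP hQ hPQ hpq hdec hal hbl
    exact ⟨P, hP, P, Q, p, q, ⟨hP, hQ, hPQ, hp, hq,
      fun i j => by linarith [h1 i, h2 j], hdec⟩, rfl⟩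
  rintro W U ⟨hW, P, Q, p, q, hsplit', hrange⟩ hU
  obtain ⟨hp, -⟩ := hsplit.eigenvalue_perturbation hrn.le hsplit'.orthonormal₁
    hsplit'.orthonormal₂ hsplit'.orthogonal (fun i j => (hsplit'.separated i j).le)
    hsplit'.decomp hal hbl
  obtain ⟨R, hR, hWR⟩ := exists_orthogonal_of_range_eq hW hsplit'.orthonormal₁ hrange
  have hUU : Uᵀ * U = 1 := (mem_orthogonalGroup_iff' _ _).1 hU.1
  have hRR : R * Rᵀ = 1 := mul_eq_one_comm.1 hR
  have hUU' : U * Uᵀ = 1 := mul_eq_one_comm.1 hUU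
  have hWU : (W * U)ᵀ * (W * U) = 1 := by
    calc (W * U)ᵀ * (W * U) = Uᵀ * (Wᵀ * W) * U := by
          simp only [transpose_mul, Matrix.mul_assoc]
      _ = 1 := by rw [hW, Matrix.mul_one, hUU]
  have hM : (A + E) * (W * U) = W * U * (Uᵀ * Rᵀ * diagonal p * R * U) := by
    calc (A + E) * (W * U) = (A + E) * P * (R * U) := by
          rw [hWR]
          simp only [Matrix.mul_assoc]
      _ = P * (R * (U * Uᵀ) * Rᵀ) * diagonal p * (R * U) := by
          rw [hsplit'.mul₁, hUU', Matrix.mul_one, hRR, Matrix.mul_one]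
      _ = _ := by
          rw [hWR]
          simp only [Matrix.mul_assoc]
  have htr := hU.trace_le hW
  have hassoc : V₁ᵀ * W * U = V₁ᵀ * (W * U) := Matrix.mul_assoc _ _ _
  have hsymm := isSymm_of_trace_le htr
  have hpos := dotProduct_mulVec_nonneg_of_trace_le htr
  rw [hassoc] at hsymm hpos
  obtain ⟨hY1, hY2⟩ := hsplit.mul_norm_compl_le hrn.le hsplit'.orthonormal₁ hsplit'.mul₁ hp hbl
  have hYP : ‖V₂ᵀ * (W * U)‖ ≤ ‖V₂ᵀ * P‖ := by
    have h1 : V₂ᵀ * (W * U) = V₂ᵀ * P * R * U := by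
      rw [hWR]
      simp only [Matrix.mul_assoc]
    rw [h1]
    exact (l2_opNorm_mul _ _).trans ((mul_le_of_le_one_right (norm_nonneg _)
      (norm_le_one_of_orthonormal hUU)).trans ((l2_opNorm_mul _ _).trans
        (mul_le_of_le_one_right (norm_nonneg _) (norm_le_one_of_orthonormal hR))))
  have hP0 := norm_nonneg (V₂ᵀ * P)
  have hE' : ‖E‖ ≤ (a - b) / 5 := hEab
  have hEn : norm2 E = ‖E‖ := rfl
  rw [hEn] at hY1 hY2
  have hEP : ‖E‖ * ‖V₂ᵀ * P‖ ≤ (a - b) / 5 * ‖V₂ᵀ * P‖ := mul_le_mul_of_nonneg_right hE' hP0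
  -- The perturbed eigenvalues stay at least `a - ‖E‖`, so the separation from `b` is at least `4/5
  -- (a - b)`, against `‖E‖ ≤ (a - b)/5`. In the next bound, absorbing `‖E‖‖V₂ᵀP‖` reduces 4/5 to
  -- 3/5.
  have hquarter : ‖V₂ᵀ * P‖ ≤ 1 / 4 := by
    refine le_of_mul_le_mul_left ?_ (sub_pos.2 hba)
    nlinarith
  have hY3 : 3 / 5 * (a - b) * ‖V₂ᵀ * P‖ ≤ norm2 (V₂ᵀ * E * V₁) := by
    have : ‖V₂ᵀ * E * V₁‖ = norm2 (V₂ᵀ * E * V₁) := rfl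
    nlinarith
  have hg0 : 0 ≤ gap V₂ (diagonal l₁) (diagonal l₂) :=
    le_min (sep_nonneg norm2_nonneg _ _) (sepOn_nonneg norm2Inf_nonneg _ _ _)
  -- The case `gap = 0` needs no proof that it is impossible: it forces `E = 0`, hence `WU = V₁`,
  -- and the quotients by `gap` are 0 by convention.
  rcases hg0.eq_or_lt with hg | hg
  · rw [← hg, zero_div] at hgap
    have hE0 : ‖E‖ = 0 := le_antisymm hgap (norm_nonneg E)
    rw [hE0] at hY1
    have hY0 : ‖V₂ᵀ * (W * U)‖ = 0 :=
      le_antisymm (hYP.trans (by nlinarith)) (norm_nonneg _)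
    obtain ⟨hdec, hC⟩ := hsplit.aligned_decomposition hrn.le hWU hsymm hpos
    rw [hY0, zero_pow two_ne_zero, norm_le_zero_iff] at hC
    rw [hdec, hC, norm_eq_zero.1 hY0, Matrix.mul_zero, Matrix.mul_zero, neg_zero, add_zero,
      norm2Inf_zero, ← hg, div_zero, zero_mul, div_zero, mul_zero, mul_zero, add_zero, add_zero]
    exact mul_nonneg (mul_nonneg (by norm_num) (norm2Inf_nonneg _)) (sq_nonneg _)
  refine hsplit.norm2Inf_sub_le hrn.le hWU hM hsymm hpos hg (hg.trans_le hgs) hgap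
    (hYP.trans hquarter) ?_
  refine le_trans ?_ hY3
  exact mul_le_mul (by linarith) hYP (norm_nonneg _) (by linarith)
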